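/- Let $\mathcal H$ be a real Hilbert space, and let $A:\mathcal H\to\mathcal H$ be a bounded self-adjoint linear operator that is positive definite in the sense that, for some $c>0$, $\langle Ay,y\rangle\ge c\|y\|^2$ for all $y\in\mathcal H$. For convex $\phi:\mathcal H\to\mathbb R$, let $\partial\phi(u)=\{\xi\in\mathcal H:\ \phi(w)\ge\phi(u)+\langle\xi,w-u\rangle\ \text{for all } w\in\mathcal H\}$. Let $\phi:\mathcal H\to[0,+\infty)$ be a damping potential, that is: $\phi$ is convex and continuous, $\phi(0)=0$, and for every $R>0$ one has $\sup_{\|u\|\le R}\|(\partial\phi)^0(u)\|<+\infty$, where $(\partial\phi)^0(u)$ is the element of minimal norm of $\partial\phi(u)$. Let $x:[0,+\infty)\to\mathcal H$ be a strong global solution of $$\ddot x(t)+\partial\phi(\dot x(t))+Ax(t)\ni 0,$$ that is: $x\in C^1([0,+\infty);\mathcal H)$; for every $T>0$, $\dot x$ is Lipschitz continuous on $[0,T]$ and $\ddot x\in L^\infty(0,T;\mathcal H)$; and the inclusion holds for almost every $t>0$. Then there is $x_\infty\in\mathcal H$ such that $$\frac1t\int_0^t x(\tau)\,d\tau\rightharpoonup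 x_\infty\quad\text{weakly in }\mathcal H\text{ as }t\to+\infty,\qquad 0\in\partial\phi(0)+Ax_\infty .$$ Moreover, if $\phi$ is (Fréchet) differentiable at $0$, then $Ax_\infty=0$, that is, $x_\infty=0$; and if $\phi(u)=r\|u\|$ for all $u\in\mathcal H$, with some $r\ge0$, then $\|Ax_\infty\|\le r$. -/

import Mathlib

open Set Filter Topology MeasureTheory
open scoped InnerProductSpace

/-- The convex subdifferential `∂φ(u)` of a real-valued function on a real Hilbert space. -/
def subdifferential {H : Type*} [NormedAddCommGroup H] [InnerProductSpace ℝ H]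
    (φ : H → ℝ) (u : H) : Set H :=
  {ξ | ∀ w : H, φ u + ⟪ξ, w - u⟫_ℝ ≤ φ w}

/-- `IsMinimalSection φ u ξ` says that `ξ = (∂φ)⁰(u)`, the element of minimal norm of `∂φ(u)`. -/
def IsMinimalSection {H : Type*} [NormedAddCommGroup H] [InnerProductSpace ℝ H]
    (φ : H → ℝ) (u ξ : H) : Prop :=
  ξ ∈ subdifferential φ u ∧ ∀ η ∈ subdifferential φ u, ‖ξ‖ ≤ ‖η‖

/-- Damping potentials: nonnegative convex continuous functions vanishing at the origin, for which
the minimal section of the subdifferential is bounded on bounded sets. -/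
structure IsDampingPotential {H : Type*} [NormedAddCommGroup H] [InnerProductSpace ℝ H]
    (φ : H → ℝ) : Prop where
  nonneg : ∀ u, 0 ≤ φ u
  convex : ConvexOn ℝ univ φ
  continuous : Continuous φ
  map_zero : φ 0 = 0
  minimalSection_bounded : ∀ R : ℝ, 0 < R →
    ∃ M : ℝ, ∀ u ξ : H, ‖u‖ ≤ R → IsMinimalSection φ u ξ → ‖ξ‖ ≤ M

/-- The velocity of a trajectory defined on `[0, +∞)` (one-sided derivative at `0`). -/
noncomputable def velocity {H : Type*} [NormedAddCommGroup H] [InnerProductSpace ℝ H]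
    (x : ℝ → H) : ℝ → H :=
  derivWithin x (Ici 0)

/-- Strong global solutions `x : [0, +∞) → H` of `0 ∈ x''(t) + ∂φ(x'(t)) + B (x(t))`.
Only the values of `x` on `[0, +∞)` matter. The acceleration is the derivative of the velocity,
which exists at almost every time because the velocity is Lipschitz on bounded intervals. -/
structure IsStrongGlobalSolution {H : Type*} [NormedAddCommGroup H] [InnerProductSpace ℝ H]
    (φ : H → ℝ) (B : H → H) (x : ℝ → H) : Prop where
  contDiffOn : ContDiffOn ℝ 1 x (Ici 0)
  velocity_lipschitz : ∀ T : ℝ, 0 < T → ∃ K : NNReal, LipschitzOnWith K (velocity x) (Icc 0 T)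
  acceleration_memLp : ∀ T : ℝ, 0 < T → MemLp (deriv (velocity x)) ⊤ (volume.restrict (Ioo 0 T))
  inclusion : ∀ᵐ t ∂(volume.restrict (Ioi (0 : ℝ))),
    DifferentiableAt ℝ (velocity x) t ∧
      ∃ ξ ∈ subdifferential φ (velocity x t), deriv (velocity x) t + ξ + B (x t) = 0

/-!
A position `p` is an equilibrium if `0 ∈ ∂φ(0) + A p`. For an equilibrium `p` and a velocity `b`,
the subgradient inequalities and the symmetry of `A` show that `‖x' - b‖² + ⟪A (x - p), x - p⟫`
grows at rate at most `2 (φ b - φ 0 + ⟪A b, x⟫)`. For `b = 0` this energy decreases. Hence `x` is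
bounded, and the difference of the energies relative to two equilibria `p` and `q` shows that
`⟪A (p - q), x t⟫` converges. For `p = 0` and arbitrary `b`, integrating and dividing by `t` gives
`φ 0 - φ b ≤ liminf ⟪A b, t⁻¹ ∫₀ᵗ x⟫`, so every weak cluster point of the averages is an
equilibrium. Two cluster points `p`, `q` then satisfy `⟪A (p - q), p - q⟫ = 0`, hence coincide.
-/

section Subdifferential

variable {H : Type*} [NormedAddCommGroup H] [InnerProductSpace ℝ H] {φ : H → ℝ} {u ξ : H}

lemma zero_mem_subdifferential_iff : 0 ∈ subdifferential φ u ↔ ∀ w, φ u ≤ φ w := by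
  simp only [subdifferential, mem_ofPred_eq, inner_zero_left, add_zero]

lemma innerSL_eq_of_mem_subdifferential {φ' : H →L[ℝ] ℝ} (hφ : HasFDerivAt φ φ' u)
    (hξ : ξ ∈ subdifferential φ u) : innerSL ℝ ξ = φ' := by
  have hmin : IsLocalMin (fun w => φ w - innerSL ℝ ξ w) u := Eventually.of_forall fun w => by
    have hw := hξ w
    rw [inner_sub_right] at hw
    simp only [innerSL_apply_apply]
    linarith
  exact (sub_eq_zero.1 (hmin.hasFDerivAt_eq_zero (hφ.sub (innerSL ℝ ξ).hasFDerivAt))).symm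

lemma subdifferential_subsingleton (hφ : DifferentiableAt ℝ φ u) :
    (subdifferential φ u).Subsingleton := fun _ hξ _ hη =>
  innerSL_inj.1 ((innerSL_eq_of_mem_subdifferential hφ.hasFDerivAt hξ).trans
    (innerSL_eq_of_mem_subdifferential hφ.hasFDerivAt hη).symm)

lemma norm_le_of_mem_subdifferential {K : NNReal} (hφ : LipschitzWith K φ)
    (hξ : ξ ∈ subdifferential φ u) : ‖ξ‖ ≤ K := by
  have hupper : φ (u + ξ) - φ u ≤ K * ‖ξ‖ := by
    simpa [Real.dist_eq] using (le_abs_self _).trans (hφ.dist_le_mul (u + ξ) u)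
  have hlower := hξ (u + ξ)
  rw [add_sub_cancel_left, real_inner_self_eq_norm_sq] at hlower
  by_contra! hlt
  nlinarith [hlt.trans_le' K.coe_nonneg]

end Subdifferential

section WeakConvergence

variable {H : Type*} [NormedAddCommGroup H] [InnerProductSpace ℝ H]

lemma continuous_inner_toWeakSpace_symm (y : H) :
    Continuous fun z : WeakSpace ℝ H => ⟪y, (toWeakSpace ℝ H).symm z⟫_ℝ :=
  WeakBilin.eval_continuous (topDualPairing ℝ H).flip (innerSL ℝ y)

lemma inner_eq_of_mapClusterPt {α : Type*} {l : Filter α} {σ : α → H} {p y : H} {c : ℝ}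
    (hp : MapClusterPt (toWeakSpace ℝ H p) l fun a => toWeakSpace ℝ H (σ a))
    (hc : Tendsto (fun a => ⟪y, σ a⟫_ℝ) l (𝓝 c)) : ⟪y, p⟫_ℝ = c := by
  obtain ⟨U, hU, hlim⟩ := mapClusterPt_iff_ultrafilter.1 hp
  exact tendsto_nhds_unique (((continuous_inner_toWeakSpace_symm y).tendsto _).comp hlim)
    (hc.mono_left hU)

variable [CompleteSpace H]

lemma isCompact_toWeakSpace_image_closedBall (C : ℝ) :
    IsCompact (toWeakSpace ℝ H '' Metric.closedBall 0 C) := by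
  let J : WeakDual ℝ H → WeakSpace ℝ H := fun f =>
    toWeakSpace ℝ H ((InnerProductSpace.toDual ℝ H).symm (WeakDual.toStrongDual f))
  have hJ : Continuous J := WeakBilin.continuous_of_continuous_eval _ fun g => by
    refine (WeakDual.eval_continuous ((InnerProductSpace.toDual ℝ H).symm g)).congr fun f => ?_
    change _ = g ((InnerProductSpace.toDual ℝ H).symm (WeakDual.toStrongDual f))
    rw [← InnerProductSpace.toDual_symm_apply, real_inner_comm,
      InnerProductSpace.toDual_symm_apply, WeakDual.toStrongDual_apply]
  have himage : J '' (WeakDual.toStrongDual ⁻¹' Metric.closedBall 0 C) =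
      toWeakSpace ℝ H '' Metric.closedBall 0 C := by
    rw [← image_image (toWeakSpace ℝ H), ← image_image (InnerProductSpace.toDual ℝ H).symm,
      image_preimage_eq _ WeakDual.toStrongDual.surjective, LinearIsometryEquiv.image_closedBall,
      map_zero]
  exact himage ▸ (WeakDual.isCompact_closedBall 0 C).image hJ

/-- Opial's argument: evaluating the limit of `⟪B (p - q), σ⟫` along two cluster points `p`, `q`
gives `⟪B (p - q), p - q⟫ = 0`. -/
lemma exists_tendsto_toWeakSpace_of_tendsto_inner_sub {α : Type*} {l : Filter α} [l.NeBot]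
    {σ : α → H} {C : ℝ} (hσ : ∀ᶠ a in l, ‖σ a‖ ≤ C) {S : Set H} {B : H → H}
    (hB : ∀ y, ⟪B y, y⟫_ℝ = 0 → y = 0)
    (hcluster : ∀ p, MapClusterPt (toWeakSpace ℝ H p) l (fun a => toWeakSpace ℝ H (σ a)) → p ∈ S)
    (hlim : ∀ p ∈ S, ∀ q ∈ S, ∃ c, Tendsto (fun a => ⟪B (p - q), σ a⟫_ℝ) l (𝓝 c)) :
    ∃ p ∈ S, Tendsto (fun a => toWeakSpace ℝ H (σ a)) l (𝓝 (toWeakSpace ℝ H p)) := by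
  have hmem : ∀ᶠ a in l, toWeakSpace ℝ H (σ a) ∈ toWeakSpace ℝ H '' Metric.closedBall 0 C :=
    hσ.mono fun a ha => mem_image_of_mem _ (mem_closedBall_zero_iff.2 ha)
  have hcompact := isCompact_toWeakSpace_image_closedBall (H := H) C
  obtain ⟨_, ⟨p, -, rfl⟩, hp⟩ := hcompact.exists_mapClusterPt (tendsto_principal.2 hmem)
  refine ⟨p, hcluster p hp, hcompact.tendsto_nhds_of_unique_mapClusterPt hmem ?_⟩
  rintro _ ⟨q, -, rfl⟩ hq
  obtain ⟨c, hc⟩ := hlim q (hcluster q hq) p (hcluster p hp)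
  have hzero : ⟪B (q - p), q - p⟫_ℝ = 0 := by
    rw [inner_sub_right, inner_eq_of_mapClusterPt hq hc, inner_eq_of_mapClusterPt hp hc, sub_self]
  rw [sub_eq_zero.1 (hB _ hzero)]

end WeakConvergence

section TimeAverage

variable {E : Type*} [NormedAddCommGroup E] [NormedSpace ℝ E] {f : ℝ → E}

/-- The Cesàro mean `t⁻¹ ∫₀ᵗ f` of a curve; it is used only for `t > 0`. -/
noncomputable def timeAverage (f : ℝ → E) (t : ℝ) : E :=
  t⁻¹ • ∫ τ in (0 : ℝ)..t, f τ

lemma norm_timeAverage_le {C t : ℝ} (ht : 0 < t) (hf : ∀ τ ∈ Ioc 0 t, ‖f τ‖ ≤ C) :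
    ‖timeAverage f t‖ ≤ C := by
  have hint : ‖∫ τ in (0 : ℝ)..t, f τ‖ ≤ C * |t - 0| :=
    intervalIntegral.norm_integral_le_of_norm_le_const (uIoc_of_le ht.le ▸ hf)
  rw [sub_zero, abs_of_pos ht, mul_comm] at hint
  rwa [timeAverage, norm_smul, norm_inv, Real.norm_of_nonneg ht.le, inv_mul_le_iff₀ ht]

lemma isLittleO_integral_of_tendsto_zero (hint : ∀ t, 0 ≤ t → IntervalIntegrable f volume 0 t)
    (hf : Tendsto f atTop (𝓝 0)) : (fun t => ∫ τ in (0 : ℝ)..t, f τ) =o[atTop] (id : ℝ → ℝ) := by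
  refine Asymptotics.isLittleO_iff.2 fun ε hε => ?_
  obtain ⟨T, hT, htail⟩ : ∃ T, 0 ≤ T ∧ ∀ t ≥ T, ‖f t‖ ≤ ε / 2 := by
    obtain ⟨N, hN⟩ := eventually_atTop.1 (hf.norm.eventually_le_const
      (by simpa using half_pos hε : ‖(0 : E)‖ < ε / 2))
    exact ⟨max N 0, le_max_right _ _, fun t ht => hN t ((le_max_left _ _).trans ht)⟩
  filter_upwards [eventually_ge_atTop T,
    (Asymptotics.isLittleO_const_id_atTop (∫ τ in (0 : ℝ)..T, f τ)).def (half_pos hε)]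
    with t hTt hhead
  have htail' : ‖∫ τ in T..t, f τ‖ ≤ ε / 2 * ‖t‖ :=
    calc ‖∫ τ in T..t, f τ‖ ≤ ε / 2 * |t - T| :=
          intervalIntegral.norm_integral_le_of_norm_le_const fun τ hτ =>
            htail τ (uIoc_of_le hTt ▸ hτ).1.le
      _ ≤ ε / 2 * ‖t‖ := by
          rw [abs_of_nonneg (sub_nonneg.2 hTt), Real.norm_of_nonneg (hT.trans hTt)]
          gcongr
          linarith
  calc ‖∫ τ in (0 : ℝ)..t, f τ‖ = ‖(∫ τ in (0 : ℝ)..T, f τ) + ∫ τ in T..t, f τ‖ := by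
        rw [intervalIntegral.integral_add_adjacent_intervals (hint T hT)
          ((hint T hT).symm.trans (hint t (hT.trans hTt)))]
    _ ≤ ε / 2 * ‖t‖ + ε / 2 * ‖t‖ := (norm_add_le _ _).trans (add_le_add hhead htail')
    _ = ε * ‖id t‖ := by rw [id]; ring

lemma inner_timeAverage {H : Type*} [NormedAddCommGroup H] [InnerProductSpace ℝ H]
    [CompleteSpace H] {x : ℝ → H} {t : ℝ} (hx : IntervalIntegrable x volume 0 t) (y : H) :
    ⟪y, timeAverage x t⟫_ℝ = timeAverage (fun τ => ⟪y, x τ⟫_ℝ) t := by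
  rw [timeAverage, real_inner_smul_right, timeAverage, smul_eq_mul]
  exact congrArg _ ((innerSL ℝ y).intervalIntegral_comp_comm hx).symm

variable [CompleteSpace E]

lemma tendsto_timeAverage {l : E} (hint : ∀ t, 0 ≤ t → IntervalIntegrable f volume 0 t)
    (hf : Tendsto f atTop (𝓝 l)) : Tendsto (timeAverage f) atTop (𝓝 l) := by
  have hzero : Tendsto (fun t : ℝ => t⁻¹ • ∫ τ in (0 : ℝ)..t, (f τ - l)) atTop (𝓝 0) :=
    (isLittleO_integral_of_tendsto_zero
      (fun t ht => (hint t ht).sub intervalIntegrable_const)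
      (tendsto_sub_nhds_zero_iff.2 hf)).tendsto_inv_smul_nhds_zero
  refine (tendsto_sub_nhds_zero_iff.1 (hzero.congr' ?_))
  filter_upwards [eventually_gt_atTop 0] with t ht
  rw [intervalIntegral.integral_sub (hint t ht.le) intervalIntegrable_const,
    intervalIntegral.integral_const, sub_zero, smul_sub, inv_smul_smul₀ ht.ne', timeAverage]

end TimeAverage

lemma exists_tendsto_atTop_of_antitoneOn {f : ℝ → ℝ} {a m : ℝ} (hf : AntitoneOn f (Ici a))
    (hm : ∀ t ∈ Ici a, m ≤ f t) : ∃ l, Tendsto f atTop (𝓝 l) :=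
  ⟨_, tendsto_comp_val_Ici_atTop.1 (tendsto_atTop_ciInf (antitoneOn_iff_antitone.1 hf)
    ⟨m, forall_mem_range.2 fun t => hm t t.2⟩)⟩

lemma sub_le_integral_of_deriv_le {f g : ℝ → ℝ} {s t : ℝ} (hst : s ≤ t)
    (hf : AbsolutelyContinuousOnInterval f s t) (hg : IntervalIntegrable g volume s t)
    (hfg : ∀ᵐ τ ∂volume.restrict (Icc s t), deriv f τ ≤ g τ) :
    f t - f s ≤ ∫ τ in s..t, g τ := by
  rw [← hf.integral_deriv_eq_sub]
  exact intervalIntegral.integral_mono_ae_restrict hst hf.intervalIntegrable_deriv hg hfg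

section Energy

variable {H : Type*} [NormedAddCommGroup H] [InnerProductSpace ℝ H]

/-- The stationary positions of `0 ∈ x'' + ∂φ(x') + B x`, that is, the points `p` with
`0 ∈ ∂φ(0) + B p`. -/
def equilibria (φ : H → ℝ) (B : H → H) : Set H :=
  {p | -B p ∈ subdifferential φ 0}

/-- Twice the mechanical energy of the trajectory `x`, measured relative to the position `p` and to
the velocity `b`. -/
noncomputable def energy (A : H →L[ℝ] H) (x : ℝ → H) (p b : H) (t : ℝ) : ℝ :=
  ‖velocity x t - b‖ ^ 2 + ⟪A (x t - p), x t - p⟫_ℝ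

variable {A : H →L[ℝ] H} {φ : H → ℝ} {x : ℝ → H} {p : H}

lemma zero_mem_equilibria (hφ : ∀ w, φ 0 ≤ φ w) : 0 ∈ equilibria φ A := by
  simpa [equilibria] using zero_mem_subdifferential_iff.2 hφ

lemma eq_zero_of_coercive {B : H → H} {c : ℝ} (hc : 0 < c)
    (hcoercive : ∀ y, c * ‖y‖ ^ 2 ≤ ⟪B y, y⟫_ℝ) {y : H} (hy : ⟪B y, y⟫_ℝ = 0) : y = 0 := by
  by_contra hne
  have hpos : 0 < c * ‖y‖ ^ 2 := by positivity
  exact (hpos.trans_le (hcoercive y)).ne' hy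

lemma energy_nonneg (hA : A.IsPositive) (b : H) (t : ℝ) : 0 ≤ energy A x p b t :=
  add_nonneg (sq_nonneg _) (hA.inner_nonneg_left _)

/-- The subgradient inequality for `ξ` at `v` is tested against `b`, the one for `-A p` at `0`
against `v`. -/
lemma inner_acceleration_add_inner_le (hA : A.IsSymmetric) (hp : p ∈ equilibria φ A)
    {y v a ξ : H} (hξ : ξ ∈ subdifferential φ v) (h : a + ξ + A y = 0) (b : H) :
    ⟪a, v - b⟫_ℝ + ⟪A (y - p), v⟫_ℝ ≤ φ b - φ 0 + ⟪A b, y⟫_ℝ := by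
  have hb := hξ b
  have hv := hp v
  have hAb : ⟪A y, b⟫_ℝ = ⟪A b, y⟫_ℝ := (real_inner_comm _ _).trans (hA b y).symm
  obtain rfl : a = -ξ - A y := by rw [← sub_eq_zero, ← h]; abel
  simp only [inner_sub_left, inner_sub_right, inner_neg_left, map_sub, inner_zero_right] at *
  linarith

namespace IsStrongGlobalSolution

variable {B : H → H}

lemma intervalIntegrable (hx : IsStrongGlobalSolution φ B x) {t : ℝ} (ht : 0 ≤ t) :
    IntervalIntegrable x volume 0 t :=
  (hx.contDiffOn.continuousOn.mono Icc_subset_Ici_self).intervalIntegrable_of_Icc ht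

lemma intervalIntegrable_inner (hx : IsStrongGlobalSolution φ B x) (y : H) {t : ℝ} (ht : 0 ≤ t) :
    IntervalIntegrable (fun τ => ⟪y, x τ⟫_ℝ) volume 0 t :=
  (continuousOn_const.inner
    (hx.contDiffOn.continuousOn.mono Icc_subset_Ici_self)).intervalIntegrable_of_Icc ht

lemma hasDerivAt (hx : IsStrongGlobalSolution φ B x) {t : ℝ} (ht : 0 < t) :
    HasDerivAt x (velocity x t) t :=
  (hx.contDiffOn.differentiableOn one_ne_zero t ht.le).hasDerivWithinAt.hasDerivAt
    (Ici_mem_nhds ht)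

lemma hasDerivAt_energy (hA : A.IsSymmetric) (hx : IsStrongGlobalSolution φ B x) (p b : H)
    {t : ℝ} (ht : 0 < t) (hv : DifferentiableAt ℝ (velocity x) t) :
    HasDerivAt (energy A x p b)
      (2 * (⟪deriv (velocity x) t, velocity x t - b⟫_ℝ + ⟪A (x t - p), velocity x t⟫_ℝ)) t := by
  have hxp : HasDerivAt (fun τ => x τ - p) (velocity x t) t := (hx.hasDerivAt ht).sub_const p
  have hAxp : HasDerivAt (fun τ => A (x τ - p)) (A (velocity x t)) t :=
    A.hasFDerivAt.comp_hasDerivAt t hxp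
  refine ((hv.hasDerivAt.sub_const b).norm_sq.add (hAxp.inner ℝ hxp)).congr_deriv ?_
  have hsymm : ⟪A (velocity x t), x t - p⟫_ℝ = ⟪A (x t - p), velocity x t⟫_ℝ :=
    (hA _ _).trans (real_inner_comm _ _)
  rw [hsymm, real_inner_comm]
  ring

lemma absolutelyContinuousOnInterval_energy (hx : IsStrongGlobalSolution φ B x)
    (A : H →L[ℝ] H) (p b : H) {s t : ℝ} (hs : 0 ≤ s) (ht : 0 ≤ t) :
    AbsolutelyContinuousOnInterval (energy A x p b) s t := by
  have hsub : uIcc s t ⊆ Ici 0 := fun τ hτ => (le_min hs ht).trans hτ.1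
  have hkinetic : AbsolutelyContinuousOnInterval (fun τ => ‖velocity x τ - b‖) s t := by
    obtain ⟨K, hK⟩ := hx.velocity_lipschitz (max s t + 1) (by positivity)
    have hK' := hK.mono (fun τ hτ => ⟨hsub hτ, hτ.2.trans (le_add_of_nonneg_right zero_le_one)⟩ :
      uIcc s t ⊆ Icc 0 (max s t + 1))
    simpa only [dist_eq_norm, Function.comp_def] using
      ((LipschitzWith.dist_left b).comp_lipschitzOnWith hK').absolutelyContinuousOnInterval
  have hpotential : ContDiffOn ℝ 1 (fun τ => ⟪A (x τ - p), x τ - p⟫_ℝ) (uIcc s t) := by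
    have hxp := (hx.contDiffOn.mono hsub).sub (contDiffOn_const (c := p))
    exact (A.contDiff.comp_contDiffOn hxp).inner ℝ hxp
  change AbsolutelyContinuousOnInterval
    (fun τ => ‖velocity x τ - b‖ ^ 2 + ⟪A (x τ - p), x τ - p⟫_ℝ) s t
  simpa only [sq] using
    (hkinetic.fun_mul hkinetic).fun_add hpotential.absolutelyContinuousOnInterval

lemma energy_sub_le (hA : A.IsSymmetric) (hx : IsStrongGlobalSolution φ A x)
    (hp : p ∈ equilibria φ A) (b : H) {s t : ℝ} (hs : 0 ≤ s) (hst : s ≤ t) :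
    energy A x p b t - energy A x p b s ≤
      ∫ τ in s..t, 2 * (φ b - φ 0 + ⟪A b, x τ⟫_ℝ) := by
  have hsub : Icc s t ⊆ Ici 0 := fun τ hτ => hs.trans hτ.1
  have hxc : ContinuousOn x (Icc s t) := hx.contDiffOn.continuousOn.mono hsub
  refine sub_le_integral_of_deriv_le hst
    (hx.absolutelyContinuousOnInterval_energy A p b hs (hs.trans hst))
    (ContinuousOn.intervalIntegrable_of_Icc hst (by fun_prop)) ?_
  rw [← restrict_Ioc_eq_restrict_Icc]
  filter_upwards [ae_restrict_of_ae_restrict_of_subset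
    (fun τ hτ => hs.trans_lt hτ.1 : Ioc s t ⊆ Ioi 0) hx.inclusion,
    ae_restrict_mem measurableSet_Ioc] with τ ⟨hv, ξ, hξ, heq⟩ hτ
  rw [(hx.hasDerivAt_energy hA p b (hs.trans_lt hτ.1) hv).deriv]
  exact mul_le_mul_of_nonneg_left (inner_acceleration_add_inner_le hA hp hξ heq b) zero_le_two

lemma energy_antitoneOn (hA : A.IsSymmetric) (hx : IsStrongGlobalSolution φ A x)
    (hp : p ∈ equilibria φ A) : AntitoneOn (energy A x p 0) (Ici 0) := fun s hs t _ hst => by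
  simpa using hx.energy_sub_le hA hp 0 hs hst

lemma exists_norm_le {c : ℝ} (hc : 0 < c) (hA : A.IsSymmetric)
    (hcoercive : ∀ y, c * ‖y‖ ^ 2 ≤ ⟪A y, y⟫_ℝ) (hφ : ∀ w, φ 0 ≤ φ w)
    (hx : IsStrongGlobalSolution φ A x) : ∃ C, ∀ t, 0 ≤ t → ‖x t‖ ≤ C := by
  refine ⟨√(energy A x 0 0 0 / c), fun t ht => Real.le_sqrt_of_sq_le ?_⟩
  rw [le_div_iff₀' hc]
  calc c * ‖x t‖ ^ 2 ≤ ⟪A (x t), x t⟫_ℝ := hcoercive _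
    _ ≤ energy A x 0 0 t := by simp [energy]
    _ ≤ energy A x 0 0 0 :=
      hx.energy_antitoneOn hA (zero_mem_equilibria hφ) self_mem_Ici ht ht

lemma exists_tendsto_inner (hA : A.IsPositive) (hx : IsStrongGlobalSolution φ A x) {q : H}
    (hp : p ∈ equilibria φ A) (hq : q ∈ equilibria φ A) :
    ∃ c, Tendsto (fun t => ⟪A (p - q), x t⟫_ℝ) atTop (𝓝 c) := by
  have henergy {r : H} (hr : r ∈ equilibria φ A) : ∃ c, Tendsto (energy A x r 0) atTop (𝓝 c) :=
    exists_tendsto_atTop_of_antitoneOn (hx.energy_antitoneOn hA.isSymmetric hr)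
      fun t _ => energy_nonneg hA 0 t
  obtain ⟨cp, hcp⟩ := henergy hp
  obtain ⟨cq, hcq⟩ := henergy hq
  refine ⟨_, (((hcq.sub hcp).add_const (⟪A p, p⟫_ℝ - ⟪A q, q⟫_ℝ)).const_mul (1 / 2)).congr
    fun t => ?_⟩
  have hsymm (r : H) : ⟪A (x t), r⟫_ℝ = ⟪A r, x t⟫_ℝ :=
    (hA.isSymmetric _ _).trans (real_inner_comm _ _)
  simp only [energy, map_sub, inner_sub_left, inner_sub_right, hsymm]
  ring

variable [CompleteSpace H]

lemma exists_le_inner_timeAverage (hA : A.IsPositive) (hφ : ∀ w, φ 0 ≤ φ w)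
    (hx : IsStrongGlobalSolution φ A x) (b : H) :
    ∃ C, ∀ t, 0 < t → φ 0 - φ b - C * t⁻¹ ≤ ⟪A b, timeAverage x t⟫_ℝ := by
  refine ⟨energy A x 0 b 0 / 2, fun t ht => ?_⟩
  have hinner : IntervalIntegrable (fun τ => ⟪A b, x τ⟫_ℝ) volume 0 t :=
    hx.intervalIntegrable_inner (A b) ht.le
  have hint := hx.energy_sub_le hA.isSymmetric (zero_mem_equilibria hφ) b le_rfl ht.le
  rw [intervalIntegral.integral_const_mul,
    intervalIntegral.integral_add intervalIntegrable_const hinner, intervalIntegral.integral_const,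
    sub_zero, smul_eq_mul] at hint
  have hnonneg : 0 ≤ energy A x 0 b t := energy_nonneg hA b t
  rw [inner_timeAverage (hx.intervalIntegrable ht.le), timeAverage, smul_eq_mul,
    le_inv_mul_iff₀ ht]
  field_simp
  linarith

lemma mem_equilibria_of_mapClusterPt (hA : A.IsPositive) (hφ : ∀ w, φ 0 ≤ φ w)
    (hx : IsStrongGlobalSolution φ A x)
    (hp : MapClusterPt (toWeakSpace ℝ H p) atTop fun t => toWeakSpace ℝ H (timeAverage x t)) :
    p ∈ equilibria φ A := by
  intro b
  obtain ⟨C, hC⟩ := hx.exists_le_inner_timeAverage hA hφ b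
  obtain ⟨U, hU, hlim⟩ := mapClusterPt_iff_ultrafilter.1 hp
  have hleft : Tendsto (fun t : ℝ => φ 0 - φ b - C * t⁻¹) U (𝓝 (φ 0 - φ b)) := by
    simpa using ((tendsto_inv_atTop_zero.const_mul C).const_sub (φ 0 - φ b)).mono_left hU
  have hright : Tendsto (fun t => ⟪A b, timeAverage x t⟫_ℝ) U (𝓝 ⟪A b, p⟫_ℝ) :=
    ((continuous_inner_toWeakSpace_symm (A b)).tendsto _).comp hlim
  have hle : φ 0 - φ b ≤ ⟪A b, p⟫_ℝ :=
    le_of_tendsto_of_tendsto hleft hright (((eventually_gt_atTop 0).mono hC).filter_mono hU)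
  have hsymm : ⟪A p, b⟫_ℝ = ⟪A b, p⟫_ℝ := (real_inner_comm _ _).trans (hA.isSymmetric b p).symm
  rw [sub_zero, inner_neg_left, hsymm]
  linarith

lemma exists_tendsto_toWeakSpace_timeAverage {c : ℝ} (hc : 0 < c) (hA : A.IsSymmetric)
    (hcoercive : ∀ y, c * ‖y‖ ^ 2 ≤ ⟪A y, y⟫_ℝ) (hφ : ∀ w, φ 0 ≤ φ w)
    (hx : IsStrongGlobalSolution φ A x) :
    ∃ p ∈ equilibria φ A,
      Tendsto (fun t => toWeakSpace ℝ H (timeAverage x t)) atTop (𝓝 (toWeakSpace ℝ H p)) := by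
  have hpos : A.IsPositive := ⟨hA, fun y => (by positivity : 0 ≤ c * ‖y‖ ^ 2).trans (hcoercive y)⟩
  obtain ⟨C, hC⟩ := hx.exists_norm_le hc hA hcoercive hφ
  refine exists_tendsto_toWeakSpace_of_tendsto_inner_sub (C := C) (B := A) ?_
    (fun _ => eq_zero_of_coercive hc hcoercive)
    (fun p => hx.mem_equilibria_of_mapClusterPt hpos hφ) fun p hp q hq => ?_
  · filter_upwards [eventually_gt_atTop 0] with t ht
    exact norm_timeAverage_le ht fun τ hτ => hC τ hτ.1.le
  · obtain ⟨l, hl⟩ := hx.exists_tendsto_inner hpos hp hq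
    refine ⟨l, (tendsto_timeAverage (fun t => hx.intervalIntegrable_inner _) hl).congr' ?_⟩
    filter_upwards [eventually_ge_atTop 0] with t ht
    exact (inner_timeAverage (hx.intervalIntegrable ht) _).symm

end IsStrongGlobalSolution

end Energy

theorem mainTheorem11_general {H : Type*} [NormedAddCommGroup H] [InnerProductSpace ℝ H]
    [CompleteSpace H]
    (A : H →L[ℝ] H) (hA : IsSelfAdjoint A)
    (hA_pos : ∃ c : ℝ, 0 < c ∧ ∀ y : H, c * ‖y‖ ^ 2 ≤ ⟪A y, y⟫_ℝ)
    (φ : H → ℝ) (hφ : ∀ w, φ 0 ≤ φ w)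
    (x : ℝ → H) (hx : IsStrongGlobalSolution φ A x) :
    ∃ x_inf : H,
      Tendsto (fun t : ℝ => toWeakSpace ℝ H (t⁻¹ • ∫ τ in (0 : ℝ)..t, x τ)) atTop
        (𝓝 (toWeakSpace ℝ H x_inf)) ∧
      (∃ ξ ∈ subdifferential φ 0, ξ + A x_inf = 0) ∧
      (DifferentiableAt ℝ φ 0 → A x_inf = 0 ∧ x_inf = 0) ∧
      (∀ r : ℝ, 0 ≤ r → (∀ u : H, φ u = r * ‖u‖) → ‖A x_inf‖ ≤ r) := by
  obtain ⟨c, hc, hcoercive⟩ := hA_pos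
  obtain ⟨p, hp, hlim⟩ :=
    hx.exists_tendsto_toWeakSpace_timeAverage hc hA.isSymmetric hcoercive hφ
  refine ⟨p, hlim, ⟨-A p, hp, neg_add_cancel _⟩, fun hdiff => ?_, fun r hr hnorm => ?_⟩
  · have hAp : A p = 0 := neg_eq_zero.1 <|
      subdifferential_subsingleton hdiff hp (zero_mem_subdifferential_iff.2 hφ)
    exact ⟨hAp, eq_zero_of_coercive hc hcoercive (by rw [hAp, inner_zero_left])⟩
  · have hLip : LipschitzWith ⟨r, hr⟩ φ := .of_dist_le_mul fun u w => by
      rw [Real.dist_eq, hnorm, hnorm, ← mul_sub, abs_mul, abs_of_nonneg hr, dist_eq_norm]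
      exact mul_le_mul_of_nonneg_left (abs_norm_sub_norm_le u w) hr
    rw [← norm_neg]
    exact norm_le_of_mem_subdifferential hLip hp

theorem mainTheorem11 {H : Type*} [NormedAddCommGroup H] [InnerProductSpace ℝ H] [CompleteSpace H]
    (A : H →L[ℝ] H) (hA : IsSelfAdjoint A)
    (hA_pos : ∃ c : ℝ, 0 < c ∧ ∀ y : H, c * ‖y‖ ^ 2 ≤ ⟪A y, y⟫_ℝ)
    (φ : H → ℝ) (hφ : IsDampingPotential φ)
    (x : ℝ → H) (hx : IsStrongGlobalSolution φ A x) :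
    ∃ x_inf : H,
      Tendsto (fun t : ℝ => toWeakSpace ℝ H (t⁻¹ • ∫ τ in (0 : ℝ)..t, x τ)) atTop
        (𝓝 (toWeakSpace ℝ H x_inf)) ∧
      (∃ ξ ∈ subdifferential φ 0, ξ + A x_inf = 0) ∧
      (DifferentiableAt ℝ φ 0 → A x_inf = 0 ∧ x_inf = 0) ∧
      (∀ r : ℝ, 0 ≤ r → (∀ u : H, φ u = r * ‖u‖) → ‖A x_inf‖ ≤ r) :=
  mainTheorem11_general A hA hA_pos φ (fun w => hφ.map_zero.trans_le (hφ.nonneg w)) x hx
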